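/- Consider a two-stage stochastic program over a probability space $(\Xi,\mathcal F,\mathbb P)$ of scenarios $\xi$ (the law of the random vector $\tilde\xi$). First-stage decisions are $y_1\in C_1\subset\mathbb R^{n_1}$ with $g_1(y_1)=0$ and cost $f_1(y_1)$; second-stage decisions are $y_2\in C_2(\xi)\subset\mathbb R^{n_2}$ with $g_2(y_1,y_2,\xi)=0$ and cost $f_2(y_1,y_2,\xi)$. Assume that $C_1$ and all $C_2(\xi)$ are convex, closed and nonempty; that $f_1$ and all $f_2(\cdot,\cdot,\xi)$ are finite and convex on $\mathbb R^{n_1}$ and $\mathbb R^{n_1}\times\mathbb R^{n_2}$ respectively; that $g_1$ and all $g_2(\cdot,\cdot,\xi)$ are affine with values in some $\mathbb R^{m_1}$, $\mathbb R^{m_2}$; and that $f_2(y_1,y_2,\cdot)$ and $g_2(y_1,y_2,\cdot)$ are measurable for each $(y_1,y_2)$ and the set-valued map $C_2$ is measurable. Put $$H(y_1,\xi)=\inf\{f_2(y_1,y_2,\xi)\mid y_2\in C_2(\xi),\ g_2(y_1,y_2,\xi)=0\},$$ and $\phi(y_1,\xi)=f_1(y_1)+H(y_1,\xi)$ if $y_1\in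 C_1$ and $g_1(y_1)=0$, $\phi(y_1,\xi)=+\infty$ otherwise. Expectations of extended-real functions are $\mathbb E[X]=\mathbb E[X^+]-\mathbb E[X^-]$, equal to $+\infty$ whenever $\mathbb E[X^+]=+\infty$. Assume that $\mathbb E[\phi(y_1,\tilde\xi)]<+\infty$ for every $y_1\in C_1$ with $g_1(y_1)=0$ (relatively complete recourse, with expected cost not equal to $+\infty$). The state-vector formulation (P-SV) is: minimize $\mathbb E[\phi(y_1(\tilde\xi),\tilde\xi)]$ over $(y_1,\chi_1)\in L^\infty_{n_1}\times\mathbb R^{n_1}$ subject to $y_1(\tilde\xi)-\chi_1=0$ almost surely, where $L^p_{n_1}=L^p(\Xi,\mathbb P;\mathbb R^{n_1})$. Let $\mathcal M=\{\sigma\in L^1_{n_1}\mid \mathbb E[\sigma(\tilde\xi)]=0\}$ and, for $\sigma\in L^1_{n_1}$, $$\mathbb L(y_1,\chi_1,\sigma)=\mathbb E\big[\phi(y_1(\tilde\xi),\tilde\xi)+\langle y_1(\tilde\xi)-\chi_1,\sigma(\tilde\xi)\rangle\big].$$ Let $(\bar y_1,\bar\chi_1)\in L^\infty_{n_1}\times\mathbb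 R^{n_1}$ satisfy $\bar y_1(\tilde\xi)=\bar\chi_1$ almost surely. Then $(\bar y_1,\bar\chi_1)$ is an optimal solution of (P-SV) if and only if there exists $\bar\sigma\in\mathcal M$ such that $$(\bar y_1,\bar\chi_1)\in\operatorname*{argmin}_{(y_1,\chi_1)\in L^\infty_{n_1}\times\mathbb R^{n_1}}\mathbb L(y_1,\chi_1,\bar\sigma).$$ Moreover, for every such $\bar\sigma$, $(\bar y_1,\bar\chi_1,\bar\sigma)$ is a saddle point of $\mathbb L$: $\mathbb L(\bar y_1,\bar\chi_1,\sigma)\le\mathbb L(\bar y_1,\bar\chi_1,\bar\sigma)\le\mathbb L(y_1,\chi_1,\bar\sigma)$ for all $\sigma\in L^1_{n_1}$ and $(y_1,\chi_1)\in L^\infty_{n_1}\times\mathbb R^{n_1}$. -/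

import Mathlib

open MeasureTheory

noncomputable section

/-- The Euclidean space `ℝⁿ`. -/
abbrev Vec (n : ℕ) : Type := EuclideanSpace ℝ (Fin n)

/-- Expectation of an extended-real random variable, `E[X⁺] - E[X⁻]`, with the usual convention of
stochastic convex programming that it is `+∞` as soon as `E[X⁺] = +∞`. -/
def extExpectation {Ξ : Type*} [MeasurableSpace Ξ] (P : Measure Ξ) (X : Ξ → EReal) : EReal :=
  if (∫⁻ ξ, (X ξ).toENNReal ∂P) = ⊤ then ⊤
  else ((∫⁻ ξ, (X ξ).toENNReal ∂P : ENNReal) : EReal)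
    - ((∫⁻ ξ, (-X ξ).toENNReal ∂P : ENNReal) : EReal)

/-- Data of a two-stage stochastic program over the scenario space `Ξ`: first-stage decisions
`y₁ ∈ C₁` with `g₁ y₁ = 0` and cost `f₁ y₁`; second-stage decisions `y₂ ∈ C₂ ξ` with
`g₂ ξ (y₁, y₂) = 0` and cost `f₂ y₁ y₂ ξ`. The constraints `g₁ = 0`, `g₂ = 0` are the (affine)
balance equations. -/
structure TwoStageProgram (n₁ n₂ m₁ m₂ : ℕ) (Ξ : Type*) where
  C₁ : Set (Vec n₁)
  g₁ : Vec n₁ →ᵃ[ℝ] Vec m₁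
  f₁ : Vec n₁ → ℝ
  C₂ : Ξ → Set (Vec n₂)
  g₂ : Ξ → ((Vec n₁ × Vec n₂) →ᵃ[ℝ] Vec m₂)
  f₂ : Vec n₁ → Vec n₂ → Ξ → ℝ

namespace TwoStageProgram

variable {n₁ n₂ m₁ m₂ : ℕ} {Ξ : Type*}

/-- Standing convexity, closedness and measurability assumptions on the data. The scenario-dependent
set `C₂` is measurable in the usual sense of set-valued maps. -/
structure IsConvex [MeasurableSpace Ξ] (S : TwoStageProgram n₁ n₂ m₁ m₂ Ξ) : Prop where
  C₁_convex : Convex ℝ S.C₁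
  C₁_closed : IsClosed S.C₁
  C₁_nonempty : S.C₁.Nonempty
  C₂_convex : ∀ ξ, Convex ℝ (S.C₂ ξ)
  C₂_closed : ∀ ξ, IsClosed (S.C₂ ξ)
  C₂_nonempty : ∀ ξ, (S.C₂ ξ).Nonempty
  C₂_measurable : ∀ U : Set (Vec n₂), IsOpen U → MeasurableSet {ξ | (S.C₂ ξ ∩ U).Nonempty}
  f₁_convex : ConvexOn ℝ Set.univ S.f₁
  f₂_convex : ∀ ξ, ConvexOn ℝ Set.univ (fun y : Vec n₁ × Vec n₂ => S.f₂ y.1 y.2 ξ)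
  f₂_measurable : ∀ y₁ y₂, Measurable (S.f₂ y₁ y₂)
  g₂_measurable : ∀ y₁ y₂, Measurable (fun ξ => S.g₂ ξ (y₁, y₂))

/-- First-stage feasible decisions. -/
def feasible₁ (S : TwoStageProgram n₁ n₂ m₁ m₂ Ξ) : Set (Vec n₁) :=
  {y₁ | y₁ ∈ S.C₁ ∧ S.g₁ y₁ = 0}

/-- Second-stage feasible decisions. -/
def feasible₂ (S : TwoStageProgram n₁ n₂ m₁ m₂ Ξ) (y₁ : Vec n₁) (ξ : Ξ) : Set (Vec n₂) :=
  {y₂ | y₂ ∈ S.C₂ ξ ∧ S.g₂ ξ (y₁, y₂) = 0}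

/-- The recourse function `H(y₁, ξ)`: the optimal second-stage cost. -/
def recourse (S : TwoStageProgram n₁ n₂ m₁ m₂ Ξ) (y₁ : Vec n₁) (ξ : Ξ) : EReal :=
  ⨅ y₂ ∈ S.feasible₂ y₁ ξ, (S.f₂ y₁ y₂ ξ : EReal)

open Classical in
/-- `φ(y₁, ξ) = f₁(y₁) + H(y₁, ξ)` if `y₁` is first-stage feasible, and `+∞` otherwise. -/
def phi (S : TwoStageProgram n₁ n₂ m₁ m₂ Ξ) (y₁ : Vec n₁) (ξ : Ξ) : EReal :=
  if y₁ ∈ S.feasible₁ then (S.f₁ y₁ : EReal) + S.recourse y₁ ξ else ⊤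

variable [MeasurableSpace Ξ]

/-- Every first-stage feasible decision has expected cost `< +∞`: recourse is relatively complete
and the objective is well defined. -/
def FiniteExpectedCost (S : TwoStageProgram n₁ n₂ m₁ m₂ Ξ) (P : Measure Ξ) : Prop :=
  ∀ y₁ ∈ S.feasible₁, extExpectation P (S.phi y₁) < ⊤

/-- The objective `E[φ(y₁(ξ), ξ)]` of the state-vector formulation. -/
def objective (S : TwoStageProgram n₁ n₂ m₁ m₂ Ξ) (P : Measure Ξ) (y₁ : Lp (Vec n₁) ⊤ P) : EReal :=
  extExpectation P (fun ξ => S.phi (y₁ ξ) ξ)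

/-- The feasible region of the state-vector formulation: `y₁(ξ) - χ₁ = 0` almost surely. -/
def stateVectorFeasible (n₁ : ℕ) (P : Measure Ξ) : Set (Lp (Vec n₁) ⊤ P × Vec n₁) :=
  {q | ∀ᵐ ξ ∂P, q.1 ξ - q.2 = 0}

/-- Optimal solutions of the state-vector formulation: minimize `E[φ(y₁(ξ), ξ)]` over
`(y₁, χ₁) ∈ L^∞ × ℝ^{n₁}` subject to `y₁(ξ) - χ₁ = 0` almost surely. -/
def IsOptimal (S : TwoStageProgram n₁ n₂ m₁ m₂ Ξ) (P : Measure Ξ)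
    (y₁ : Lp (Vec n₁) ⊤ P) (χ₁ : Vec n₁) : Prop :=
  (y₁, χ₁) ∈ stateVectorFeasible n₁ P ∧
    ∀ q ∈ stateVectorFeasible n₁ P, S.objective P y₁ ≤ S.objective P q.1

/-- The multipliers: `σ ∈ L¹` with `E[σ] = 0`. -/
def multipliers (n₁ : ℕ) (P : Measure Ξ) : Set (Lp (Vec n₁) 1 P) :=
  {σ | ∫ ξ, σ ξ ∂P = 0}

/-- The Lagrangian `E[φ(y₁(ξ), ξ) + ⟨y₁(ξ) - χ₁, σ(ξ)⟩]`. -/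
def lagrangian (S : TwoStageProgram n₁ n₂ m₁ m₂ Ξ) (P : Measure Ξ)
    (y₁ : Lp (Vec n₁) ⊤ P) (χ₁ : Vec n₁) (σ : Lp (Vec n₁) 1 P) : EReal :=
  extExpectation P
    (fun ξ => S.phi (y₁ ξ) ξ + ((inner ℝ (y₁ ξ - χ₁) (σ ξ) : ℝ) : EReal))

/-- `(y₁, χ₁)` minimizes the Lagrangian with multiplier `σ` over all of `L^∞ × ℝ^{n₁}`. -/
def MinimizesLagrangian (S : TwoStageProgram n₁ n₂ m₁ m₂ Ξ) (P : Measure Ξ)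
    (y₁ : Lp (Vec n₁) ⊤ P) (χ₁ : Vec n₁) (σ : Lp (Vec n₁) 1 P) : Prop :=
  ∀ (y : Lp (Vec n₁) ⊤ P) (χ : Vec n₁), S.lagrangian P y₁ χ₁ σ ≤ S.lagrangian P y χ σ

/-- `(y₁, χ₁, σ)` is a saddle point of the Lagrangian on `(L^∞ × ℝ^{n₁}) × L¹`: minimal in the
decisions, maximal in the multiplier. -/
def IsLagrangianSaddlePoint (S : TwoStageProgram n₁ n₂ m₁ m₂ Ξ) (P : Measure Ξ)
    (y₁ : Lp (Vec n₁) ⊤ P) (χ₁ : Vec n₁) (σ : Lp (Vec n₁) 1 P) : Prop :=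
  (∀ τ : Lp (Vec n₁) 1 P, S.lagrangian P y₁ χ₁ τ ≤ S.lagrangian P y₁ χ₁ σ) ∧
    ∀ (y : Lp (Vec n₁) ⊤ P) (χ : Vec n₁), S.lagrangian P y₁ χ₁ σ ≤ S.lagrangian P y χ σ

end TwoStageProgram

end

/-! On feasible pairs the coupling term vanishes, so the Lagrangian equals the objective whatever
the multiplier (`lagrangian_eq`). This gives sufficiency and the saddle inequality. The substance is
to find, at an optimum of finite value, an integrable mean-zero `σ` such that almost surely `φ(χ, ξ)
≤ φ(y, ξ) + ⟨y - χ, σ(ξ)⟩` for all `y`.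

In coordinates on the span of the feasible directions (`IsMinimalIntegrand`), optimality says that
constant directions have nonnegative expected cost increment. The M. Riesz extension theorem carries
this positivity over to scenario-dependent simple directions (`exists_linear`). Evaluation on
indicator directions yields set functions that are only finitely additive (`exists_charges`). A
Yosida–Hewitt decomposition (`IsCharge.exists_density`) gives them integrable densities on a
countable partition, plus a mass `m` that escapes along the tails.

Under relatively complete recourse the coordinate domain `D` does not depend on the scenario and
costs are integrable on it, so the tail limit gives `0 ≤ ∑ i, c i * m i` for every `c ∈ D`. The
escaped mass can then be returned as a constant: this restores mean zero and preserves every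
scenario inequality (`IsMinimalIntegrand.exists_multiplier`). Null sets are collected over rational
points only; convexity reaches the others. -/

/-! ### Measurability of sublevel events of set-valued maps -/

/-- For a measurable set-valued map `C` and a Carathéodory function `h`, the event that `C ξ` meets
the open strict sublevel set of `h` is measurable. -/
theorem measurableSet_exists_mem_lt {Ξ X : Type*} [MeasurableSpace Ξ] [TopologicalSpace X]
    [SecondCountableTopology X] {C : Ξ → Set X} {h : X → Ξ → ℝ}
    (hC : ∀ U : Set X, IsOpen U → MeasurableSet {ξ | (C ξ ∩ U).Nonempty})
    (hcont : ∀ ξ, Continuous fun y => h y ξ) (hmeas : ∀ y, Measurable (h y)) (ε : ℝ) :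
    MeasurableSet {ξ | ∃ y ∈ C ξ, h y ξ < ε} := by
  obtain ⟨D, hDc, hDd⟩ := TopologicalSpace.exists_countable_dense X
  -- By continuity, a bound on the countably many dense points of an open `U` holds on all of `U`;
  -- the margin `1 / (k + 1)` keeps the inequality strict.
  have key : {ξ | ∃ y ∈ C ξ, h y ξ < ε} =
      ⋃ U ∈ TopologicalSpace.countableBasis X, ⋃ k : ℕ,
        ({ξ | (C ξ ∩ U).Nonempty} ∩ ⋂ d ∈ D ∩ U, {ξ | h d ξ ≤ ε - 1 / ((k : ℝ) + 1)}) := by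
    ext ξ
    simp only [Set.mem_ofPred_eq, Set.mem_iUnion, Set.mem_inter_iff, Set.mem_iInter, exists_prop]
    constructor
    · rintro ⟨y, hy, hlt⟩
      obtain ⟨k, hk⟩ := exists_nat_one_div_lt (sub_pos.2 hlt)
      have hopen : IsOpen {z | h z ξ < ε - 1 / ((k : ℝ) + 1)} :=
        isOpen_lt (hcont ξ) continuous_const
      obtain ⟨U, hU, hyU, hUs⟩ := (TopologicalSpace.isBasis_countableBasis X).exists_subset_of_mem_open
        (show y ∈ {z | h z ξ < ε - 1 / ((k : ℝ) + 1)} by simp only [Set.mem_ofPred_eq]; linarith) hopen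
      exact ⟨U, hU, k, ⟨y, hy, hyU⟩, fun d hd => le_of_lt (hUs hd.2)⟩
    · rintro ⟨U, hU, k, ⟨y, hy, hyU⟩, hd⟩
      refine ⟨y, hy, ?_⟩
      have hpos : 0 < 1 / ((k : ℝ) + 1) := by positivity
      by_contra hcon
      have hopen : IsOpen (U ∩ {z | ε - 1 / ((k : ℝ) + 1) < h z ξ}) :=
        (TopologicalSpace.isOpen_of_mem_countableBasis hU).inter
          (isOpen_lt continuous_const (hcont ξ))
      obtain ⟨d, hd1, hd2⟩ := hDd.inter_open_nonempty _ hopen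
        ⟨y, hyU, by simp only [Set.mem_ofPred_eq]; linarith⟩
      exact absurd (hd d ⟨hd2, hd1.1⟩) (not_le.2 hd1.2)
  rw [key]
  refine MeasurableSet.biUnion (TopologicalSpace.countable_countableBasis X) fun U hU => ?_
  refine MeasurableSet.iUnion fun k => (hC U (TopologicalSpace.isOpen_of_mem_countableBasis hU)).inter ?_
  exact MeasurableSet.biInter (hDc.mono Set.inter_subset_left) fun d _ =>
    measurableSet_le (hmeas d) measurable_const

/-- The closed version of `measurableSet_exists_mem_lt`, for closed values and compact sublevels. -/
theorem measurableSet_exists_mem_le {Ξ X : Type*} [MeasurableSpace Ξ] [TopologicalSpace X]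
    [T2Space X] [SecondCountableTopology X] {C : Ξ → Set X} {h : X → Ξ → ℝ} {K : Set X}
    (hC : ∀ U : Set X, IsOpen U → MeasurableSet {ξ | (C ξ ∩ U).Nonempty})
    (hCc : ∀ ξ, IsClosed (C ξ)) (hK : IsCompact K) (hKh : ∀ y ξ, h y ξ ≤ 1 → y ∈ K)
    (hcont : ∀ ξ, Continuous fun y => h y ξ) (hmeas : ∀ y, Measurable (h y)) :
    MeasurableSet {ξ | ∃ y ∈ C ξ, h y ξ ≤ 0} := by
  have key : {ξ | ∃ y ∈ C ξ, h y ξ ≤ 0} =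
      ⋂ k : ℕ, {ξ | ∃ y ∈ C ξ, h y ξ < 1 / ((k : ℝ) + 1)} := by
    ext ξ
    simp only [Set.mem_ofPred_eq, Set.mem_iInter]
    constructor
    · rintro ⟨y, hy, hle⟩ k
      exact ⟨y, hy, hle.trans_lt (by positivity)⟩
    · intro hk
      have hcl : ∀ k : ℕ, IsClosed (C ξ ∩ {y | h y ξ ≤ 1 / ((k : ℝ) + 1)}) := fun k =>
        (hCc ξ).inter (isClosed_le (hcont ξ) continuous_const)
      obtain ⟨y, hy⟩ := IsCompact.nonempty_iInter_of_sequence_nonempty_isCompact_isClosed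
        (fun k : ℕ => C ξ ∩ {y | h y ξ ≤ 1 / ((k : ℝ) + 1)})
        (fun k y hy => ⟨hy.1, le_trans (Set.mem_ofPred_eq ▸ hy.2)
          (one_div_le_one_div_of_le (by positivity : (0 : ℝ) < k + 1) (by push_cast; linarith))⟩)
        (fun k => (hk k).imp fun y hy => ⟨hy.1, hy.2.le⟩)
        (hK.of_isClosed_subset (hcl 0) fun y hy => hKh y ξ (by simpa using hy.2)) hcl
      rw [Set.mem_iInter] at hy
      refine ⟨y, (hy 0).1, ge_of_tendsto' tendsto_one_div_add_atTop_nhds_zero_nat fun k => (hy k).2⟩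
  rw [key]
  exact MeasurableSet.iInter fun k => measurableSet_exists_mem_lt hC hcont hmeas _

/-! ### Measurability and convexity of the scenario cost -/

namespace TwoStageProgram

variable {n₁ n₂ m₁ m₂ : ℕ} {Ξ : Type*} {S : TwoStageProgram n₁ n₂ m₁ m₂ Ξ}

theorem recourse_lt_iff {y₁ : Vec n₁} {ξ : Ξ} {α : EReal} :
    S.recourse y₁ ξ < α ↔ ∃ y₂ ∈ S.feasible₂ y₁ ξ, (S.f₂ y₁ y₂ ξ : EReal) < α := by
  simp [recourse, iInf_lt_iff]

theorem mem_feasible₁_of_phi_ne_top {y : Vec n₁} {ξ : Ξ} (h : S.phi y ξ ≠ ⊤) :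
    y ∈ S.feasible₁ := by
  by_contra hy
  exact h (by simp [phi, hy])

section Measurability

variable [MeasurableSpace Ξ]

theorem IsConvex.measurable_recourse (hS : S.IsConvex) (y₁ : Vec n₁) :
    Measurable (S.recourse y₁) := by
  have hf : ∀ ξ, Continuous fun y₂ => S.f₂ y₁ y₂ ξ := fun ξ =>
    (continuousOn_univ.1 ((hS.f₂_convex ξ).continuousOn isOpen_univ)).comp
      (Continuous.prodMk_right y₁)
  have hg : ∀ ξ, Continuous fun y₂ => S.g₂ ξ (y₁, y₂) := fun ξ =>
    (S.g₂ ξ).continuous_of_finiteDimensional.comp (Continuous.prodMk_right y₁)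
  -- The balance equation is not an open condition, so norm bound, equation and cost bound are
  -- merged into one closed inequality. The norm bound supplies compactness.
  have hA : ∀ (N : ℕ) (r : ℚ), MeasurableSet {ξ | ∃ y₂ ∈ S.C₂ ξ,
      max (‖y₂‖ - N) (max ‖S.g₂ ξ (y₁, y₂)‖ (S.f₂ y₁ y₂ ξ - r)) ≤ 0} := fun N r =>
    measurableSet_exists_mem_le (K := Metric.closedBall 0 (N + 1)) hS.C₂_measurable hS.C₂_closed
      (isCompact_closedBall _ _)
      (fun y ξ h => by
        have := (le_max_left _ _).trans h
        rw [mem_closedBall_zero_iff]; linarith)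
      (fun ξ => (continuous_norm.sub continuous_const).max
        ((hg ξ).norm.max ((hf ξ).sub continuous_const)))
      (fun y => measurable_const.max ((hS.g₂_measurable y₁ y).norm.max
        ((hS.f₂_measurable y₁ y).sub measurable_const)))
  refine measurable_of_Iio fun α => ?_
  have key : S.recourse y₁ ⁻¹' Set.Iio α = ⋃ (N : ℕ) (r : ℚ) (_ : ((r : ℝ) : EReal) < α),
      {ξ | ∃ y₂ ∈ S.C₂ ξ,
        max (‖y₂‖ - N) (max ‖S.g₂ ξ (y₁, y₂)‖ (S.f₂ y₁ y₂ ξ - r)) ≤ 0} := by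
    ext ξ
    simp only [Set.mem_preimage, Set.mem_Iio, recourse_lt_iff, Set.mem_iUnion, Set.mem_ofPred_eq,
      exists_prop, feasible₂, max_le_iff, norm_le_zero_iff, sub_nonpos]
    constructor
    · rintro ⟨y, ⟨hy, hgy⟩, hlt⟩
      obtain ⟨N, hN⟩ := exists_nat_ge ‖y‖
      obtain ⟨r, hr1, hr2⟩ := EReal.lt_iff_exists_rat_btwn.1 hlt
      exact ⟨N, r, hr2, y, hy, hN, hgy, le_of_lt (EReal.coe_lt_coe_iff.1 hr1)⟩
    · rintro ⟨N, r, hr, y, hy, -, hgy, hle⟩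
      exact ⟨y, ⟨hy, hgy⟩, lt_of_le_of_lt (EReal.coe_le_coe_iff.2 hle) hr⟩
  rw [key]
  exact .iUnion fun N => .iUnion fun r => .iUnion fun _ => hA N r

theorem IsConvex.measurable_phi (hS : S.IsConvex) (y₁ : Vec n₁) : Measurable (S.phi y₁) := by
  unfold phi
  split_ifs
  · exact measurable_const.add (hS.measurable_recourse y₁)
  · exact measurable_const

theorem IsConvex.convex_feasible₁ (hS : S.IsConvex) : Convex ℝ S.feasible₁ :=
  hS.C₁_convex.inter ((convex_singleton (0 : Vec m₁)).affine_preimage S.g₁)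

theorem IsConvex.phi_combo_le (hS : S.IsConvex) {ξ : Ξ} {x y : Vec n₁} {α β a b : ℝ}
    (hx : S.phi x ξ ≤ α) (hy : S.phi y ξ ≤ β) (ha : 0 ≤ a) (hb : 0 ≤ b) (hab : a + b = 1) :
    S.phi (a • x + b • y) ξ ≤ ((a * α + b * β : ℝ) : EReal) := by
  have hxf := mem_feasible₁_of_phi_ne_top (hx.trans_lt (EReal.coe_lt_top _)).ne
  have hyf := mem_feasible₁_of_phi_ne_top (hy.trans_lt (EReal.coe_lt_top _)).ne
  have hzf := hS.convex_feasible₁ hxf hyf ha hb hab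
  -- The recourse infimum need not be attained, so near-optimal second-stage decisions are combined.
  have hrec : ∀ {z : Vec n₁} {γ ε : ℝ}, z ∈ S.feasible₁ → S.phi z ξ ≤ γ → 0 < ε →
      ∃ z₂ ∈ S.feasible₂ z ξ, S.f₁ z + S.f₂ z z₂ ξ < γ + ε := by
    intro z γ ε hz hγ hε
    have h1 : S.recourse z ξ < ((γ + ε - S.f₁ z : ℝ) : EReal) := by
      simp only [phi, hz, if_true] at hγ
      by_contra! hcon
      have h2 : ((S.f₁ z : ℝ) : EReal) + ((γ + ε - S.f₁ z : ℝ) : EReal) ≤ γ :=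
        (add_le_add le_rfl hcon).trans hγ
      rw [← EReal.coe_add, EReal.coe_le_coe_iff] at h2
      linarith
    obtain ⟨z₂, hz₂, hlt⟩ := recourse_lt_iff.1 h1
    exact ⟨z₂, hz₂, by linarith [EReal.coe_lt_coe_iff.1 hlt]⟩
  refine EReal.le_of_forall_lt_iff_le.1 fun γ hγ => ?_
  rw [EReal.coe_lt_coe_iff] at hγ
  obtain ⟨x₂, hx₂, hxlt⟩ := hrec hxf hx (sub_pos.2 hγ)
  obtain ⟨y₂, hy₂, hylt⟩ := hrec hyf hy (sub_pos.2 hγ)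
  have hmem : a • x₂ + b • y₂ ∈ S.feasible₂ (a • x + b • y) ξ := by
    refine ⟨hS.C₂_convex ξ hx₂.1 hy₂.1 ha hb hab, ?_⟩
    have h := (convex_singleton (0 : Vec m₂)).affine_preimage (S.g₂ ξ)
    exact h (x := (x, x₂)) hx₂.2 (y := (y, y₂)) hy₂.2 ha hb hab
  have h1 := hS.f₁_convex.2 (Set.mem_univ x) (Set.mem_univ y) ha hb hab
  have h2 := (hS.f₂_convex ξ).2 (Set.mem_univ (x, x₂)) (Set.mem_univ (y, y₂)) ha hb hab
  simp only [smul_eq_mul, Prod.smul_mk, Prod.mk_add_mk] at h1 h2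
  rw [phi, if_pos hzf]
  refine (add_le_add le_rfl (iInf₂_le _ hmem)).trans ?_
  rw [← EReal.coe_add, EReal.coe_le_coe_iff]
  have h3 := mul_le_mul_of_nonneg_left hxlt.le ha
  have h4 := mul_le_mul_of_nonneg_left hylt.le hb
  have h5 : γ - (a * α + b * β) = a * (γ - (a * α + b * β)) + b * (γ - (a * α + b * β)) := by
    rw [← add_mul, hab, one_mul]
  linarith

end Measurability

end TwoStageProgram

/-! ### Charges and their densities -/

/-- A nonnegative finitely additive set function on the measurable sets. -/
structure IsCharge {Ξ : Type*} [MeasurableSpace Ξ] (ν : Set Ξ → ℝ) : Prop where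
  nonneg : ∀ S, MeasurableSet S → 0 ≤ ν S
  union : ∀ S T, MeasurableSet S → MeasurableSet T → Disjoint S T → ν (S ∪ T) = ν S + ν T

namespace IsCharge

open Filter Topology

variable {Ξ : Type*} [MeasurableSpace Ξ] {ν : Set Ξ → ℝ}

theorem empty (hν : IsCharge ν) : ν ∅ = 0 := by
  have := hν.union ∅ ∅ .empty .empty (by simp)
  simp at this
  exact this

theorem diff_add (hν : IsCharge ν) {S T : Set Ξ} (hS : MeasurableSet S) (hT : MeasurableSet T)
    (h : S ⊆ T) : ν S + ν (T \ S) = ν T := by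
  rw [← hν.union _ _ hS (hT.diff hS) Set.disjoint_sdiff_right, Set.union_sdiff_cancel h]

theorem mono (hν : IsCharge ν) {S T : Set Ξ} (hS : MeasurableSet S) (hT : MeasurableSet T)
    (h : S ⊆ T) : ν S ≤ ν T := by
  linarith [hν.diff_add hS hT h, hν.nonneg _ (hT.diff hS)]

theorem inter (hν : IsCharge ν) {R : Set Ξ} (hR : MeasurableSet R) :
    IsCharge fun S => ν (S ∩ R) where
  nonneg S hS := hν.nonneg _ (hS.inter hR)
  union S T hS hT h := by
    rw [Set.union_inter_distrib_right]
    exact hν.union _ _ (hS.inter hR) (hT.inter hR)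
      (h.mono Set.inter_subset_left Set.inter_subset_left)

theorem sum {ι : Type*} {s : Finset ι} {ν : ι → Set Ξ → ℝ} (hν : ∀ i, IsCharge (ν i)) :
    IsCharge fun S => ∑ i ∈ s, ν i S where
  nonneg S hS := Finset.sum_nonneg fun i _ => (hν i).nonneg S hS
  union S T hS hT h := by
    rw [← Finset.sum_add_distrib]
    exact Finset.sum_congr rfl fun i _ => (hν i).union S T hS hT h

theorem compl_iUnion_add_sum (hν : IsCharge ν) {f : ℕ → Set Ξ} (hf : ∀ n, MeasurableSet (f n))
    (hd : Pairwise (Function.onFun Disjoint f)) {A : Set Ξ} (hA : MeasurableSet A)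
    (hfA : ∀ n, f n ⊆ A) (n : ℕ) :
    ν (A \ ⋃ k < n, f k) + ∑ k ∈ Finset.range n, ν (f k) = ν A := by
  induction n with
  | zero => simp
  | succ n ih =>
    rw [Finset.sum_range_succ, ← ih]
    have hm : MeasurableSet (A \ ⋃ k < n, f k) :=
      hA.diff (.iUnion fun k => .iUnion fun _ => hf k)
    have hsub : f n ⊆ A \ ⋃ k < n, f k := by
      refine Set.subset_sdiff.2 ⟨hfA n, ?_⟩
      simp only [Set.disjoint_iUnion_right]
      exact fun k hk => hd hk.ne'
    rw [← hν.diff_add (hf n) hm hsub, Set.sdiff_sdiff, Set.biUnion_lt_succ]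
    ring

/-- A charge dominated by a multiple of a finite measure is itself a measure. -/
theorem exists_measure_of_le (hν : IsCharge ν) {P : Measure Ξ} [IsFiniteMeasure P] {c : ℝ}
    (hc : ∀ S, MeasurableSet S → ν S ≤ c * P.real S) :
    ∃ μ : Measure Ξ, ∀ S, MeasurableSet S → μ S = ENNReal.ofReal (ν S) := by
  refine ⟨Measure.ofMeasurable (fun S _ => ENNReal.ofReal (ν S)) (by simp [hν.empty]) ?_,
    fun S hS => Measure.ofMeasurable_apply S hS⟩
  intro f hf hd
  have hm : MeasurableSet (⋃ i, f i) := .iUnion hf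
  have hsum : HasSum (fun i => ν (f i)) (ν (⋃ i, f i)) := by
    rw [hasSum_iff_tendsto_nat_of_nonneg (fun i => hν.nonneg _ (hf i))]
    -- Continuity of `P` from above squeezes the tails of `ν`, which upgrades finite to countable
    -- additivity.
    have hP : Tendsto (fun n => c * P.real ((⋃ i, f i) \ ⋃ k < n, f k)) atTop (𝓝 (c * 0)) := by
      refine Tendsto.const_mul c ?_
      have h0 : (⋂ n : ℕ, (⋃ i, f i) \ ⋃ k < n, f k) = ∅ := by
        ext x
        simp only [Set.mem_iInter, Set.mem_sdiff, Set.mem_iUnion, Set.mem_empty_iff_false,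
          iff_false, not_forall, exists_prop, not_and, not_not]
        by_cases hx : ∃ i, x ∈ f i
        · obtain ⟨i, hi⟩ := hx
          exact ⟨i + 1, fun _ => ⟨i, i.lt_succ_self, hi⟩⟩
        · exact ⟨0, fun h => absurd h hx⟩
      have := tendsto_measure_iInter_atTop (μ := P)
        (s := fun n : ℕ => (⋃ i, f i) \ ⋃ k < n, f k)
        (fun n => (hm.diff (.iUnion fun k => .iUnion fun _ => hf k)).nullMeasurableSet)
        (fun m n hmn => Set.sdiff_subset_sdiff_right
          (Set.biUnion_subset_biUnion_left fun k hk => lt_of_lt_of_le hk hmn))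
        ⟨0, measure_ne_top _ _⟩
      rw [h0, measure_empty] at this
      exact (ENNReal.tendsto_toReal ENNReal.zero_ne_top).comp this
    rw [mul_zero] at hP
    have hz : Tendsto (fun n : ℕ => ν ((⋃ i, f i) \ ⋃ k < n, f k)) atTop (𝓝 0) :=
      squeeze_zero (fun n => hν.nonneg _ (hm.diff (.iUnion fun k => .iUnion fun _ => hf k)))
        (fun n => hc _ (hm.diff (.iUnion fun k => .iUnion fun _ => hf k))) hP
    have := (tendsto_const_nhds (x := ν (⋃ i, f i))).sub hz
    rw [sub_zero] at this
    refine this.congr fun n => ?_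
    rw [← hν.compl_iUnion_add_sum hf hd hm (Set.subset_iUnion f) n]
    ring
  rw [← hsum.tsum_eq, ENNReal.ofReal_tsum_of_nonneg (fun i => hν.nonneg _ (hf i)) hsum.summable]

/-- An approximate Hahn decomposition. For a charge the supremum of `ν - c P` need not be attained,
so `B` only comes within `δ` of it. -/
theorem exists_subset_sub_le (hν : IsCharge ν) (P : Measure Ξ) [IsFiniteMeasure P] {c δ : ℝ}
    (hc : 0 ≤ c) (hδ : 0 < δ) {A : Set Ξ} (hA : MeasurableSet A) :
    ∃ B ⊆ A, MeasurableSet B ∧ c * P.real B ≤ ν B ∧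
      ∀ S ⊆ A \ B, MeasurableSet S → ν S ≤ c * P.real S + δ := by
  by_cases h : ∀ S ⊆ A, MeasurableSet S → ν S ≤ c * P.real S + δ
  · exact ⟨∅, Set.empty_subset _, .empty, by simp [hν.empty], by simpa using h⟩
  push Not at h
  obtain ⟨S₁, hS₁A, hS₁, hlt₁⟩ := h
  set V : Set ℝ := {v | ∃ S ⊆ A, MeasurableSet S ∧ v = ν S - c * P.real S}
  have hbdd : BddAbove V := by
    refine ⟨ν A, ?_⟩
    rintro v ⟨S, hSA, hS, rfl⟩
    have : 0 ≤ c * P.real S := mul_nonneg hc measureReal_nonneg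
    linarith [hν.mono hS hA hSA]
  have hne : V.Nonempty := ⟨_, S₁, hS₁A, hS₁, rfl⟩
  have hle₁ := le_csSup hbdd ⟨S₁, hS₁A, hS₁, rfl⟩
  -- The violating set `S₁` pushes the supremum above `δ`, so a set within `δ` of it has positive
  -- excess.
  obtain ⟨v, ⟨B, hBA, hB, rfl⟩, hlt⟩ := exists_lt_of_lt_csSup hne (sub_lt_self (sSup V) hδ)
  refine ⟨B, hBA, hB, by linarith, fun S hSB hS => ?_⟩
  have hd : Disjoint B S := (Set.subset_sdiff.1 hSB).2.symm
  have := le_csSup hbdd ⟨B ∪ S, Set.union_subset hBA (hSB.trans Set.sdiff_subset), hB.union hS, rfl⟩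
  rw [hν.union _ _ hB hS hd, measureReal_union hd hS] at this
  linarith

/-- Off a set of small measure, a charge is dominated by a multiple of the reference measure. -/
theorem exists_dominated (hν : IsCharge ν) (P : Measure Ξ) [IsFiniteMeasure P] {c : ℝ}
    (hc : 0 < c) : ∃ T, MeasurableSet T ∧ P.real Tᶜ ≤ ν Set.univ / c ∧
      ∀ S ⊆ T, MeasurableSet S → ν S ≤ c * P.real S := by
  -- Excess sets are removed repeatedly with errors `1 / (n + 1)`; on the intersection of the
  -- remainders the error disappears.
  choose B hBA hB hBν hBle using fun (n : ℕ) (A : {A : Set Ξ // MeasurableSet A}) =>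
    hν.exists_subset_sub_le P hc.le (Nat.one_div_pos_of_nat (α := ℝ) (n := n)) A.2
  let T : ℕ → {A : Set Ξ // MeasurableSet A} := fun n =>
    Nat.rec ⟨Set.univ, .univ⟩ (fun n A => ⟨A.1 \ B n A, A.2.diff (hB n A)⟩) n
  have hTs : ∀ n, (T (n + 1)).1 = (T n).1 \ B n (T n) := fun n => rfl
  have hanti : Antitone fun n => (T n).1 := antitone_nat_of_succ_le fun n => by
    rw [hTs]; exact Set.sdiff_subset
  have hTc : ∀ n, c * P.real (T n).1ᶜ ≤ ν (T n).1ᶜ := by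
    intro n
    induction n with
    | zero => simp [T, hν.empty]
    | succ n ih =>
      have hd : Disjoint (T n).1ᶜ (B n (T n)) :=
        Set.disjoint_compl_left_iff_subset.2 (hBA n (T n))
      rw [hTs, Set.compl_sdiff, Set.union_comm, hν.union _ _ (T n).2.compl (hB _ _) hd,
        measureReal_union hd (hB _ _)]
      linarith [hBν n (T n)]
  refine ⟨⋂ n, (T n).1, .iInter fun n => (T n).2, ?_, fun S hST hS => ?_⟩
  · have hlim : Tendsto (fun n => P.real (T n).1ᶜ) atTop (𝓝 (P.real (⋂ n, (T n).1)ᶜ)) := by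
      rw [Set.compl_iInter]
      exact (ENNReal.tendsto_toReal (measure_ne_top _ _)).comp
        (tendsto_measure_iUnion_atTop fun m n h => Set.compl_subset_compl.2 (hanti h))
    refine le_of_tendsto' hlim fun n => ?_
    rw [le_div_iff₀ hc, mul_comm]
    exact (hTc n).trans (hν.mono (T n).2.compl .univ (Set.subset_univ _))
  · have : Tendsto (fun n : ℕ => c * P.real S + 1 / ((n : ℝ) + 1)) atTop
        (𝓝 (c * P.real S + 0)) := tendsto_const_nhds.add tendsto_one_div_add_atTop_nhds_zero_nat
    rw [add_zero] at this
    refine ge_of_tendsto' this fun n => hBle n (T n) S ?_ hS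
    rw [← hTs]
    exact hST.trans (Set.iInter_subset (fun n => (T n).1) (n + 1))

/-- Simultaneous Yosida–Hewitt decomposition: finitely many charges vanishing on null sets have
integrable densities on the pieces of a countable partition. -/
theorem exists_density {ι : Type*} [Fintype ι] {ν : ι → Set Ξ → ℝ} (hν : ∀ i, IsCharge (ν i))
    (P : Measure Ξ) [IsFiniteMeasure P] :
    ∃ (R : ℕ → Set Ξ) (h : ι → Ξ → ℝ), (∀ n, MeasurableSet (R n)) ∧ (∀ᵐ ξ ∂P, ∃ n, ξ ∈ R n) ∧
      (∀ i, Integrable (h i) P) ∧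
      (∀ i n, ∀ S ⊆ R n, MeasurableSet S → ν i S = ∫ ξ in S, h i ξ ∂P) ∧
      ∀ i, Tendsto (fun n : ℕ => ν i (⋃ k < n, R k)ᶜ) atTop (𝓝 (ν i Set.univ - ∫ ξ, h i ξ ∂P)) := by
  have hsum : IsCharge fun S => ∑ i, ν i S := IsCharge.sum hν
  have hle : ∀ i S, MeasurableSet S → ν i S ≤ ∑ i, ν i S := fun i S hS =>
    Finset.single_le_sum (f := fun i => ν i S) (fun j _ => (hν j).nonneg S hS) (Finset.mem_univ i)
  -- Dominating the sum of the charges gives one partition that serves all of them.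
  choose T hT hTc hTle using fun n : ℕ => hsum.exists_dominated P (Nat.cast_add_one_pos (α := ℝ) n)
  set R := disjointed T with hR
  have hRm : ∀ n, MeasurableSet (R n) := fun n => .disjointed hT n
  have hRT : ∀ n, R n ⊆ T n := disjointed_le T
  have hRd : Pairwise (Function.onFun Disjoint R) := disjoint_disjointed T
  have hcover : ∀ᵐ ξ ∂P, ∃ n, ξ ∈ R n := by
    have h0 : P.real (⋃ n, T n)ᶜ = 0 := by
      refine le_antisymm ?_ measureReal_nonneg
      have hlim : Tendsto (fun n : ℕ => (∑ i, ν i Set.univ) * (1 / ((n : ℝ) + 1))) atTop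
          (𝓝 ((∑ i, ν i Set.univ) * 0)) :=
        tendsto_one_div_add_atTop_nhds_zero_nat.const_mul _
      rw [mul_zero] at hlim
      refine ge_of_tendsto' hlim fun n => ?_
      rw [mul_one_div]
      exact (measureReal_mono (Set.compl_subset_compl.2 (Set.subset_iUnion T n))).trans (hTc n)
    rw [measureReal_eq_zero_iff, ← iUnion_disjointed] at h0
    filter_upwards [measure_eq_zero_iff_ae_notMem.1 h0] with ξ hξ
    simpa using hξ
  have hμ : ∀ i n, ∃ μ : Measure Ξ, ∀ S, MeasurableSet S →
      μ S = ENNReal.ofReal (ν i (S ∩ R n)) := fun i n =>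
    ((hν i).inter (hRm n)).exists_measure_of_le (P := P) (c := n + 1) fun S hS =>
      (hle i _ (hS.inter (hRm n))).trans <|
      (hTle n _ (Set.inter_subset_right.trans (hRT n)) (hS.inter (hRm n))).trans
        (mul_le_mul_of_nonneg_left (measureReal_mono Set.inter_subset_left) (by positivity))
  choose μ hμ using hμ
  have hfin : ∀ i, IsFiniteMeasure (Measure.sum (μ i)) := fun i => by
    refine ⟨?_⟩
    rw [Measure.sum_apply _ .univ]
    refine lt_of_le_of_lt (ENNReal.tsum_le_of_sum_range_le (c := ENNReal.ofReal (ν i Set.univ))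
      fun n => ?_) ENNReal.ofReal_lt_top
    simp only [hμ i _ _ MeasurableSet.univ, Set.univ_inter]
    rw [← ENNReal.ofReal_sum_of_nonneg fun k _ => (hν i).nonneg _ (hRm k)]
    refine ENNReal.ofReal_le_ofReal ?_
    rw [← (hν i).compl_iUnion_add_sum hRm hRd .univ (fun _ => Set.subset_univ _) n]
    linarith [(hν i).nonneg (Set.univ \ ⋃ k < n, R k)
      (.diff .univ (.iUnion fun k => .iUnion fun _ => hRm k))]
  have hac : ∀ i, Measure.sum (μ i) ≪ P := fun i => by
    refine Measure.AbsolutelyContinuous.mk fun S hS h0 => ?_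
    rw [Measure.sum_apply _ hS, ENNReal.tsum_eq_zero]
    intro n
    rw [hμ i n S hS, ENNReal.ofReal_eq_zero]
    refine (hle i _ (hS.inter (hRm n))).trans
      ((hTle n _ (Set.inter_subset_right.trans (hRT n)) (hS.inter (hRm n))).trans ?_)
    rw [measureReal_def, measure_mono_null Set.inter_subset_left h0]
    simp
  have hloc : ∀ i n, ∀ S ⊆ R n, MeasurableSet S →
      ν i S = ∫ ξ in S, ((Measure.sum (μ i)).rnDeriv P ξ).toReal ∂P := fun i n S hSR hS => by
    rw [Measure.setIntegral_toReal_rnDeriv (hac i), measureReal_def, Measure.sum_apply _ hS,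
      tsum_eq_single n, hμ i n S hS, Set.inter_eq_left.2 hSR,
      ENNReal.toReal_ofReal ((hν i).nonneg S hS)]
    intro k hk
    rw [hμ i k S hS, ((hRd hk).symm.mono_left hSR).inter_eq, (hν i).empty, ENNReal.ofReal_zero]
  have hint : ∀ i, Integrable (fun ξ => ((Measure.sum (μ i)).rnDeriv P ξ).toReal) P := fun i =>
    Measure.integrable_toReal_rnDeriv
  refine ⟨R, fun i ξ => ((Measure.sum (μ i)).rnDeriv P ξ).toReal, hRm, hcover, hint, hloc,
    fun i => ?_⟩
  have hs := hasSum_integral_iUnion hRm hRd (hint i).integrableOn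
  have huniv : P.restrict (⋃ n, R n) = P :=
    Measure.restrict_eq_self_of_ae_mem (hcover.mono fun ξ h => Set.mem_iUnion.2 h)
  rw [huniv] at hs
  refine (hs.tendsto_sum_nat.const_sub (ν i Set.univ)).congr fun n => ?_
  rw [← (hν i).compl_iUnion_add_sum hRm hRd .univ (fun _ => Set.subset_univ _) n,
    ← Set.compl_eq_univ_sdiff]
  simp only [fun k => (hloc i k _ subset_rfl (hRm k)).symm]
  ring

end IsCharge

/-! ### Minimal integrands and the Riesz extension -/

/-- A convex integrand `ψ` on `ι → ℝ` with effective domain in `D`, finite and equal to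
the integrable function `u c` almost surely at each `c ∈ D`, and whose integral over `D` is minimal
at the origin; `D` contains the origin and the standard basis. -/
structure IsMinimalIntegrand {Ξ ι : Type*} [MeasurableSpace Ξ] [Fintype ι] [DecidableEq ι]
    (P : Measure Ξ) (D : Set (ι → ℝ)) (ψ : (ι → ℝ) → Ξ → EReal) (u : (ι → ℝ) → Ξ → ℝ) : Prop where
  zero_mem : 0 ∈ D
  single_mem : ∀ i, Pi.single i 1 ∈ D
  mem_of_ne_top : ∀ c ξ, ψ c ξ ≠ ⊤ → c ∈ D
  convex_epigraph : ∀ ξ, Convex ℝ {p : (ι → ℝ) × ℝ | ψ p.1 ξ ≤ p.2}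
  integrable : ∀ c ∈ D, Integrable (u c) P
  ae_eq : ∀ c ∈ D, ∀ᵐ ξ ∂P, ψ c ξ = u c ξ
  integral_le : ∀ c ∈ D, ∫ ξ, u 0 ξ ∂P ≤ ∫ ξ, u c ξ ∂P

namespace IsMinimalIntegrand

open Filter Topology

variable {Ξ ι : Type*} [MeasurableSpace Ξ] [Fintype ι] [DecidableEq ι]
  {P : Measure Ξ} {D : Set (ι → ℝ)} {ψ : (ι → ℝ) → Ξ → EReal} {u : (ι → ℝ) → Ξ → ℝ}

theorem combo_le (h : IsMinimalIntegrand P D ψ u) {ξ : Ξ} {x y : ι → ℝ} {α β a b : ℝ}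
    (hx : ψ x ξ ≤ α) (hy : ψ y ξ ≤ β) (ha : 0 ≤ a) (hb : 0 ≤ b) (hab : a + b = 1) :
    ψ (a • x + b • y) ξ ≤ ((a * α + b * β : ℝ) : EReal) :=
  h.convex_epigraph ξ (x := (x, α)) hx (y := (y, β)) hy ha hb hab

theorem le_of_mem_simplex (h : IsMinimalIntegrand P D ψ u) {ξ : Ξ} {M : ℝ} (h0 : ψ 0 ξ ≤ M)
    (he : ∀ i, ψ (Pi.single i 1) ξ ≤ M) {c : ι → ℝ} (hc : ∀ i, 0 ≤ c i) (hc1 : ∑ i, c i ≤ 1) :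
    ψ c ξ ≤ M := by
  have hconv : Convex ℝ {x | ψ x ξ ≤ M} := fun x hx y hy a b ha hb hab => by
    have := h.combo_le hx hy ha hb hab
    rwa [← add_mul, hab, one_mul] at this
  -- The extra index `none` is the vertex `0`; it carries the slack weight `1 - ∑ i, c i`.
  have := hconv.sum_mem (t := Finset.univ)
    (w := fun o : Option ι => o.elim (1 - ∑ i, c i) c)
    (z := fun o : Option ι => o.elim 0 fun i => Pi.single i 1)
    (by rintro (_ | i) -
        · simpa using hc1
        · exact hc i)
    (by simp [Fintype.sum_option])
    (by rintro (_ | i) -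
        · exact h0
        · exact he i)
  simp only [Fintype.sum_option, Option.elim, smul_zero, zero_add] at this
  have hsum : ∑ i, c i • (Pi.single i 1 : ι → ℝ) = c := by
    ext j
    simp [Finset.sum_apply, Pi.single_apply]
  rwa [hsum] at this

/-- A subgradient inequality at rational points extends to all points. -/
theorem le_add_of_forall_rat (h : IsMinimalIntegrand P D ψ u) {ξ : Ξ} {v M : ℝ} (h0 : ψ 0 ξ ≤ M)
    (he : ∀ i, ψ (Pi.single i 1) ξ ≤ M) {s : ι → ℝ}
    (hq : ∀ q : ι → ℚ, (v : EReal) ≤ ψ (fun i => q i) ξ + ((∑ i, (q i : ℝ) * s i : ℝ) : EReal))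
    (c : ι → ℝ) : (v : EReal) ≤ ψ c ξ + ((∑ i, c i * s i : ℝ) : EReal) := by
  have hreal : ∀ α : ℝ, ψ c ξ ≤ α → v ≤ α + ∑ i, c i * s i := by
    intro α hα
    set d : ℝ := ((Fintype.card ι : ℕ) : ℝ) with hd
    have hd0 : 0 ≤ d := Nat.cast_nonneg _
    have hstep : ∀ t : ℝ, 0 < t → t ≤ 1 →
        v ≤ α + ∑ i, c i * s i + t * ((M - α) + ∑ i, (|c i| + 1) * |s i|) := by
      intro t ht ht1
      -- A rational point `q = (1 - t) c + t b` is chosen near `c`. The width `t / (d + 1)` puts `b`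
      -- in the simplex, where `ψ ≤ M`, so convexity bounds `ψ` at `q` without any semicontinuity.
      have hex : ∀ i, ∃ q : ℚ, (1 - t) * c i < q ∧ (q : ℝ) < (1 - t) * c i + t * (1 / (d + 1)) :=
        fun i => exists_rat_btwn (lt_add_of_pos_right _ (by positivity))
      choose q hq1 hq2 using hex
      set b : ι → ℝ := fun i => ((q i : ℝ) - (1 - t) * c i) / t with hb
      have hb0 : ∀ i, 0 ≤ b i := fun i => div_nonneg (by linarith [hq1 i]) ht.le
      have hb1 : ∀ i, b i ≤ 1 / (d + 1) := fun i => by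
        rw [hb, div_le_iff₀ ht]; linarith [hq2 i]
      have hbsum : ∑ i, b i ≤ 1 := by
        refine (Finset.sum_le_sum fun i _ => hb1 i).trans ?_
        rw [Finset.sum_const, Finset.card_univ, nsmul_eq_mul, mul_one_div, ← hd,
          div_le_one (by positivity)]
        linarith
      have hcombo := h.combo_le hα (h.le_of_mem_simplex h0 he hb0 hbsum)
        (sub_nonneg.2 ht1) ht.le (sub_add_cancel 1 t)
      have heq : (1 - t) • c + t • b = fun i => (q i : ℝ) := by
        ext i
        simp only [hb, Pi.add_apply, Pi.smul_apply, smul_eq_mul]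
        field_simp
        ring
      rw [heq] at hcombo
      have hle := (hq q).trans (add_le_add hcombo le_rfl)
      rw [← EReal.coe_add, EReal.coe_le_coe_iff] at hle
      have hterm : ∀ i, (q i : ℝ) * s i ≤ c i * s i + t * ((|c i| + 1) * |s i|) := by
        intro i
        have hone : 1 / (d + 1) ≤ 1 := by
          rw [div_le_one (by positivity)]; linarith
        have h1 : |(q i : ℝ) - c i| ≤ t * (|c i| + 1) := by
          have h2 := mul_le_mul_of_nonneg_left hone ht.le
          have h3 := mul_le_mul_of_nonneg_left (le_abs_self (c i)) ht.le
          have h4 := mul_le_mul_of_nonneg_left (neg_abs_le (c i)) ht.le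
          rw [abs_le]
          constructor <;> linarith [hq1 i, hq2 i]
        have h5 : ((q i : ℝ) - c i) * s i ≤ t * (|c i| + 1) * |s i| := by
          refine (le_abs_self _).trans ?_
          rw [abs_mul]
          exact mul_le_mul_of_nonneg_right h1 (abs_nonneg _)
        linarith
      have hsum := Finset.sum_le_sum fun i (_ : i ∈ Finset.univ) => hterm i
      rw [Finset.sum_add_distrib, ← Finset.mul_sum] at hsum
      linarith
    have hlim : Tendsto (fun n : ℕ => α + ∑ i, c i * s i +
        1 / ((n : ℝ) + 1) * ((M - α) + ∑ i, (|c i| + 1) * |s i|)) atTop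
        (𝓝 (α + ∑ i, c i * s i + 0 * ((M - α) + ∑ i, (|c i| + 1) * |s i|))) :=
      tendsto_const_nhds.add (tendsto_one_div_add_atTop_nhds_zero_nat.mul_const _)
    rw [zero_mul, add_zero] at hlim
    refine ge_of_tendsto' hlim fun n => hstep _ (by positivity) ?_
    rw [div_le_one (by positivity)]
    linarith [Nat.cast_nonneg (α := ℝ) n]
  have hsub : ((v - ∑ i, c i * s i : ℝ) : EReal) ≤ ψ c ξ := by
    refine EReal.le_of_forall_lt_iff_le.1 fun α hα => ?_
    rw [EReal.coe_le_coe_iff]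
    linarith [hreal α hα.le]
  calc (v : EReal) = ((v - ∑ i, c i * s i : ℝ) : EReal) + ((∑ i, c i * s i : ℝ) : EReal) := by
        rw [← EReal.coe_add, sub_add_cancel]
    _ ≤ _ := add_le_add hsub le_rfl

/-- The cone of pairs `(y, a)` for which `a` dominates a positive multiple of the increment of `ψ`
at the origin in the scenario-dependent direction `y`. -/
def incrementCone (h : IsMinimalIntegrand P D ψ u) :
    PointedCone ℝ ((SimpleFunc Ξ (ι → ℝ)) × Lp ℝ 1 P) where
  carrier := {z | ∃ t : ℝ, 0 < t ∧ ∀ᵐ ξ ∂P, ψ (t • z.1 ξ) ξ ≤ ((u 0 ξ + t * z.2 ξ : ℝ) : EReal)}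
  zero_mem' := by
    refine ⟨1, one_pos, ?_⟩
    filter_upwards [h.ae_eq 0 h.zero_mem, Lp.coeFn_zero ℝ 1 P] with ξ h1 h2
    change ψ ((1 : ℝ) • (0 : ι → ℝ)) ξ ≤ ((u 0 ξ + 1 * (0 : Lp ℝ 1 P) ξ : ℝ) : EReal)
    rw [smul_zero, h2, Pi.zero_apply, mul_zero, add_zero, h1]
  add_mem' := by
    rintro ⟨y, a⟩ ⟨y', a'⟩ ⟨t, ht, hy⟩ ⟨t', ht', hy'⟩
    -- This scale makes `y + y'` times it the convex combination of `t y` and `t' y'` with weights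
    -- `t' / (t + t')` and `t / (t + t')`.
    refine ⟨t * t' / (t + t'), by positivity, ?_⟩
    filter_upwards [hy, hy', Lp.coeFn_add a a'] with ξ h1 h2 h3
    have hne : t + t' ≠ 0 := by positivity
    have := h.combo_le h1 h2 (a := t' / (t + t')) (b := t / (t + t')) (by positivity)
      (by positivity) (by field_simp; ring)
    convert! this using 2
    · ext i
      simp only [Prod.fst_add, SimpleFunc.coe_add, Pi.add_apply, Pi.smul_apply, smul_eq_mul]
      field_simp
    · simp only [Prod.snd_add, h3, Pi.add_apply]
      field_simp
      ring
  smul_mem' := by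
    rintro ⟨r, hr⟩ ⟨y, a⟩ ⟨t, ht, hy⟩
    rcases hr.eq_or_lt with rfl | hr
    · refine ⟨1, one_pos, ?_⟩
      filter_upwards [h.ae_eq 0 h.zero_mem, Lp.coeFn_zero ℝ 1 P] with ξ h1 h2
      have e1 : ((⟨0, hr⟩ : {r : ℝ // 0 ≤ r}) • (y, a)) = 0 := zero_smul _ _
      rw [e1]
      change ψ ((1 : ℝ) • (0 : ι → ℝ)) ξ ≤ ((u 0 ξ + 1 * (0 : Lp ℝ 1 P) ξ : ℝ) : EReal)
      rw [smul_zero, h2, Pi.zero_apply, mul_zero, add_zero, h1]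
    · refine ⟨t / r, by positivity, ?_⟩
      filter_upwards [hy, Lp.coeFn_smul r a] with ξ h1 h2
      have e1 : ((⟨r, hr.le⟩ : {r : ℝ // 0 ≤ r}) • (y, a)) = (r • y, r • a) := rfl
      rw [e1]
      convert! h1 using 2
      · simp only [SimpleFunc.coe_smul, Pi.smul_apply, smul_smul]
        congr 1
        field_simp
      · simp only [h2, Pi.smul_apply, smul_eq_mul]
        field_simp

theorem exists_linear (h : IsMinimalIntegrand P D ψ u) [IsProbabilityMeasure P] :
    ∃ g : (SimpleFunc Ξ (ι → ℝ)) × Lp ℝ 1 P →ₗ[ℝ] ℝ,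
      (∀ c a, g (SimpleFunc.const Ξ c, a) = ∫ ξ, a ξ ∂P) ∧ ∀ z ∈ h.incrementCone, 0 ≤ g z := by
  let dom : Submodule ℝ ((SimpleFunc Ξ (ι → ℝ)) × Lp ℝ 1 P) :=
    { carrier := {z | ∃ c, z.1 = SimpleFunc.const Ξ c}
      zero_mem' := ⟨0, rfl⟩
      add_mem' := by
        rintro z z' ⟨c, hc⟩ ⟨c', hc'⟩
        exact ⟨c + c', by rw [Prod.fst_add, hc, hc']; rfl⟩
      smul_mem' := by
        rintro r z ⟨c, hc⟩
        exact ⟨r • c, by rw [Prod.smul_fst, hc]; rfl⟩ }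
  let I : (SimpleFunc Ξ (ι → ℝ)) × Lp ℝ 1 P →ₗ[ℝ] ℝ :=
    { toFun := fun z => ∫ ξ, z.2 ξ ∂P
      map_add' := fun z z' => by
        rw [Prod.snd_add, integral_congr_ae (Lp.coeFn_add z.2 z'.2)]
        exact integral_add (L1.integrable_coeFn _) (L1.integrable_coeFn _)
      map_smul' := fun r z => by
        rw [Prod.smul_snd, integral_congr_ae (Lp.coeFn_smul r z.2)]
        exact integral_const_mul r fun ξ => z.2 ξ }
  suffices hex : ∃ g : (SimpleFunc Ξ (ι → ℝ)) × Lp ℝ 1 P →ₗ[ℝ] ℝ,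
      (∀ z : dom, g z = I z) ∧ ∀ z ∈ h.incrementCone, 0 ≤ g z by
    obtain ⟨g, hg, hpos⟩ := hex
    exact ⟨g, fun c a => hg ⟨(SimpleFunc.const Ξ c, a), c, rfl⟩, hpos⟩
  refine riesz_extension h.incrementCone (⟨dom, I.comp dom.subtype⟩ : _ →ₗ.[ℝ] ℝ) ?_ ?_
  · rintro ⟨⟨y, a⟩, c, hc⟩ ⟨t, ht, hy⟩
    change y = _ at hc
    subst hc
    change 0 ≤ ∫ ξ, a ξ ∂P
    simp only [SimpleFunc.coe_const, Function.const_apply] at hy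
    -- One scenario suffices to place `t • c` in `D`, since `D` does not depend on the scenario.
    obtain ⟨ξ₀, hξ₀⟩ := hy.exists
    have hD : t • c ∈ D := h.mem_of_ne_top _ ξ₀ (hξ₀.trans_lt (EReal.coe_lt_top _)).ne
    have ha : Integrable (fun ξ => a ξ) P := L1.integrable_coeFn a
    have hle : ∫ ξ, u (t • c) ξ ∂P ≤ ∫ ξ, (u 0 ξ + t * a ξ) ∂P := by
      refine integral_mono_ae (h.integrable _ hD)
        ((h.integrable _ h.zero_mem).add (ha.const_mul t)) ?_
      filter_upwards [hy, h.ae_eq _ hD] with ξ h1 h2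
      rwa [h2, EReal.coe_le_coe_iff] at h1
    rw [integral_add (h.integrable _ h.zero_mem) (ha.const_mul t), integral_const_mul] at hle
    have := h.integral_le _ hD
    exact nonneg_of_mul_nonneg_right (by linarith) ht
  -- Cofinality: adding the constant `N` makes the direction nonnegative, the scale `t` brings it
  -- into the simplex, and the integrable bound `M` controls `ψ` there.
  · rintro ⟨y, a⟩
    obtain ⟨C, hC⟩ := y.exists_forall_norm_le
    set N : ℝ := max C 0
    have hN : 0 ≤ N := le_max_right _ _
    have hyN : ∀ ξ i, |y ξ i| ≤ N := fun ξ i =>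
      (norm_le_pi_norm (y ξ) i).trans ((hC ξ).trans (le_max_left _ _))
    set d : ℝ := ((Fintype.card ι : ℕ) : ℝ) with hd
    have hd0 : 0 ≤ d := Nat.cast_nonneg _
    set t : ℝ := 1 / (d * (2 * N) + 1) with ht
    have ht0 : 0 < t := by positivity
    set M : Ξ → ℝ := fun ξ => |u 0 ξ| + ∑ i, |u (Pi.single i 1) ξ| with hM
    have hu0 := h.integrable _ h.zero_mem
    have hMi : Integrable M P :=
      hu0.abs.add (integrable_finsetSum _ fun i _ => (h.integrable _ (h.single_mem i)).abs)
    have hbi : Integrable (fun ξ => (M ξ - u 0 ξ) / t) P := (hMi.sub hu0).div_const t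
    refine ⟨⟨(SimpleFunc.const Ξ fun _ => N, hbi.toL1 _ - a), _, rfl⟩, t, ht0, ?_⟩
    have hall : ∀ᵐ ξ ∂P, ∀ i, ψ (Pi.single i 1) ξ = u (Pi.single i 1) ξ :=
      ae_all_iff.2 fun i => h.ae_eq _ (h.single_mem i)
    filter_upwards [h.ae_eq 0 h.zero_mem, hall, Lp.coeFn_add (hbi.toL1 _ - a) a,
      Lp.coeFn_sub (hbi.toL1 _) a, hbi.coeFn_toL1] with ξ h1 h2 h3 h4 h5
    have hval : u 0 ξ + t * ((hbi.toL1 _ - a) + a) ξ = M ξ := by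
      rw [h3, Pi.add_apply, h4, Pi.sub_apply, h5]
      field_simp
      ring
    change ψ (t • ((SimpleFunc.const Ξ fun _ => N) + y : SimpleFunc Ξ (ι → ℝ)) ξ) ξ ≤
      ((u 0 ξ + t * ((hbi.toL1 _ - a) + a) ξ : ℝ) : EReal)
    rw [hval]
    have hsn : 0 ≤ ∑ i, |u (Pi.single i 1) ξ| := Finset.sum_nonneg fun i _ => abs_nonneg _
    have hci : ∀ i, (t • ((SimpleFunc.const Ξ fun _ => N) + y : SimpleFunc Ξ (ι → ℝ)) ξ) i = t * (N + y ξ i) :=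
      fun i => rfl
    refine h.le_of_mem_simplex ?_ ?_ ?_ ?_
    · rw [h1, EReal.coe_le_coe_iff]
      linarith [le_abs_self (u 0 ξ)]
    · intro i
      rw [h2 i, EReal.coe_le_coe_iff]
      have := Finset.single_le_sum (f := fun i => |u (Pi.single i 1) ξ|)
        (fun j _ => abs_nonneg _) (Finset.mem_univ i)
      linarith [le_abs_self (u (Pi.single i 1) ξ), abs_nonneg (u 0 ξ)]
    · intro i
      rw [hci]
      have := neg_abs_le (y ξ i)
      exact mul_nonneg ht0.le (by linarith [hyN ξ i])
    · simp only [hci]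
      have : ∀ i ∈ Finset.univ, t * (N + y ξ i) ≤ t * (2 * N) := fun i _ =>
        mul_le_mul_of_nonneg_left (by linarith [hyN ξ i, le_abs_self (y ξ i)]) ht0.le
      refine (Finset.sum_le_sum this).trans ?_
      rw [Finset.sum_const, Finset.card_univ, nsmul_eq_mul, ← hd, ht, one_div_mul_eq_div,
        mul_div_assoc', div_le_one (by positivity)]
      linarith

end IsMinimalIntegrand

/-! ### From the linear extension to an integrable multiplier -/

namespace IsMinimalIntegrand

open Filter Topology

variable {Ξ ι : Type*} [MeasurableSpace Ξ] [Fintype ι] [DecidableEq ι]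
  {P : Measure Ξ} {D : Set (ι → ℝ)} {ψ : (ι → ℝ) → Ξ → EReal} {u : (ι → ℝ) → Ξ → ℝ}

theorem integrable_sub (h : IsMinimalIntegrand P D ψ u) {c : ι → ℝ} (hc : c ∈ D) :
    Integrable (fun ξ => u c ξ - u 0 ξ) P :=
  (h.integrable c hc).sub (h.integrable 0 h.zero_mem)

/-- The values of a Riesz extension on indicator directions, in charge form. -/
theorem exists_charges (h : IsMinimalIntegrand P D ψ u) [IsProbabilityMeasure P] :
    ∃ γ : ι → Set Ξ → ℝ, (∀ i, γ i Set.univ = 0) ∧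
      ∀ c ∈ D, IsCharge fun S => ∑ i, c i * γ i S + ∫ ξ in S, (u c ξ - u 0 ξ) ∂P := by
  obtain ⟨g, hg, hpos⟩ := h.exists_linear
  set e : ι → Set Ξ → SimpleFunc Ξ (ι → ℝ) := fun i S =>
    (SimpleFunc.const Ξ (Pi.single i 1)).restrict S with he
  have hadd : ∀ i S T, MeasurableSet S → MeasurableSet T → Disjoint S T →
      e i (S ∪ T) = e i S + e i T := fun i S T hS hT hd => by
    ext1 ξ
    rw [SimpleFunc.coe_add, Pi.add_apply, SimpleFunc.restrict_apply _ (hS.union hT),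
      SimpleFunc.restrict_apply _ hS, SimpleFunc.restrict_apply _ hT,
      Set.indicator_union_of_disjoint hd]
  have hzero : ∀ a : Lp ℝ 1 P, g (0, a) = ∫ ξ, a ξ ∂P := fun a => by
    rw [← hg 0 a]
    rfl
  have hsplit : ∀ y (a : Lp ℝ 1 P), g (y, a) = g (y, 0) + ∫ ξ, a ξ ∂P := fun y a => by
    rw [← hzero, ← map_add, Prod.mk_add_mk, add_zero, zero_add]
  refine ⟨fun i S => g (e i S, 0), fun i => ?_, fun c hc => ⟨fun S hS => ?_, ?_⟩⟩
  · simp only [he, SimpleFunc.restrict_univ]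
    rw [hg, integral_congr_ae (Lp.coeFn_zero ℝ 1 P)]
    simp
  · have hi : Integrable (S.indicator fun ξ => u c ξ - u 0 ξ) P := (h.integrable_sub hc).indicator hS
    -- Moving by `c` on `S` and staying at the origin elsewhere lies in the cone at scale `1`;
    -- positivity of `g` there is nonnegativity of the charge.
    have hmem : (∑ i, c i • e i S, hi.toL1 _) ∈ h.incrementCone := by
      refine ⟨1, one_pos, ?_⟩
      filter_upwards [h.ae_eq c hc, h.ae_eq 0 h.zero_mem, hi.coeFn_toL1] with ξ h1 h2 h3
      have hval : (∑ i, c i • e i S) ξ = S.indicator (fun _ => c) ξ := by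
        ext j
        let ev : SimpleFunc Ξ (ι → ℝ) →+ ℝ :=
          { toFun := fun y => y ξ j, map_zero' := rfl, map_add' := fun _ _ => rfl }
        change ev (∑ i, c i • e i S) = _
        rw [map_sum]
        change ∑ i, (c i • e i S) ξ j = _
        simp only [SimpleFunc.coe_smul, Pi.smul_apply, he, SimpleFunc.restrict_apply _ hS]
        by_cases hξ : ξ ∈ S <;> simp [hξ, Pi.single_apply]
      change ψ ((1 : ℝ) • (∑ i, c i • e i S) ξ) ξ ≤ ((u 0 ξ + 1 * (hi.toL1 _ ξ) : ℝ) : EReal)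
      rw [hval, h3, one_smul, one_mul]
      by_cases hξ : ξ ∈ S
      · simp only [Set.indicator_of_mem hξ, h1, add_sub_cancel, le_refl]
      · simp only [Set.indicator_of_notMem hξ, h2, add_zero, le_refl]
    have hnn := hpos _ hmem
    rw [hsplit, integral_congr_ae hi.coeFn_toL1, integral_indicator hS] at hnn
    have hlin : g (∑ i, c i • e i S, 0) = ∑ i, c i * g (e i S, 0) := by
      change g (LinearMap.inl ℝ _ _ (∑ i, c i • e i S)) = _
      rw [map_sum, map_sum]
      exact Finset.sum_congr rfl fun i _ => by rw [map_smul, map_smul]; rfl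
    rwa [hlin] at hnn
  · intro S T hS hT hd
    have hgadd : ∀ i, g (e i (S ∪ T), 0) = g (e i S, 0) + g (e i T, 0) := fun i => by
      rw [hadd i S T hS hT hd, ← map_add, Prod.mk_add_mk, add_zero]
    simp only [hgadd, mul_add, Finset.sum_add_distrib]
    rw [setIntegral_union hd hT (h.integrable_sub hc).integrableOn
      (h.integrable_sub hc).integrableOn]
    ring

/-- Existence of an integrable multiplier with mean zero. -/
theorem exists_multiplier (h : IsMinimalIntegrand P D ψ u) [IsProbabilityMeasure P] :
    ∃ s : ι → Ξ → ℝ, (∀ i, Integrable (s i) P) ∧ (∀ i, ∫ ξ, s i ξ ∂P = 0) ∧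
      ∀ᵐ ξ ∂P, ∀ c, (u 0 ξ : EReal) ≤ ψ c ξ + ((∑ i, c i * s i ξ : ℝ) : EReal) := by
  obtain ⟨γ, hγ, hN⟩ := h.exists_charges
  set w : ι → Ξ → ℝ := fun i ξ => u (Pi.single i 1) ξ - u 0 ξ with hw
  have hwi : ∀ i, Integrable (w i) P := fun i => h.integrable_sub (h.single_mem i)
  have hνc : ∀ i, IsCharge fun S => γ i S + ∫ ξ in S, w i ξ ∂P := fun i => by
    have := hN _ (h.single_mem i)
    simpa [Pi.single_apply] using this
  obtain ⟨R, f, hRm, hcover, hfi, hloc, hlim⟩ := IsCharge.exists_density hνc P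
  set m : ι → ℝ := fun i => ∫ ξ, w i ξ ∂P - ∫ ξ, f i ξ ∂P with hm
  have hlim' : ∀ i, Tendsto (fun n : ℕ => γ i (⋃ k < n, R k)ᶜ +
      ∫ ξ in (⋃ k < n, R k)ᶜ, w i ξ ∂P) atTop (𝓝 (m i)) := fun i => by
    have := hlim i
    simpa only [hγ, setIntegral_univ, zero_add] using this
  set Z : ℕ → Set Ξ := fun n => (⋃ k < n, R k)ᶜ with hZ
  have hZm : ∀ n, MeasurableSet (Z n) := fun n =>
    (MeasurableSet.iUnion fun k => .iUnion fun _ => hRm k).compl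
  have hvanish : ∀ f : Ξ → ℝ, Integrable f P →
      Tendsto (fun n => ∫ ξ in Z n, f ξ ∂P) atTop (𝓝 0) := fun f hf => by
    have := tendsto_setIntegral_of_antitone (f := f) (μ := P) hZm
      (fun m n hmn => Set.compl_subset_compl.2
        (Set.biUnion_subset_biUnion_left fun k hk => lt_of_lt_of_le hk hmn)) ⟨0, hf.integrableOn⟩
    have h0 : P (⋂ n, Z n) = 0 := by
      refine measure_mono_null ?_ hcover
      intro ξ hξ hex
      obtain ⟨n, hn⟩ := hex
      exact Set.mem_iInter.1 hξ (n + 1) (Set.mem_biUnion (Nat.lt_succ_self n) hn)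
    rwa [Measure.restrict_eq_zero.2 h0, integral_zero_measure] at this
  have hfw : ∀ i, Integrable (fun ξ => f i ξ - w i ξ) P := fun i => (hfi i).sub (hwi i)
  have hki : ∀ c ∈ D, Integrable (fun ξ => ∑ i, c i * (f i ξ - w i ξ) + (u c ξ - u 0 ξ)) P :=
    fun c hc => (integrable_finsetSum _ fun i _ => (hfw i).const_mul (c i)).add
      (h.integrable_sub hc)
  have hdens : ∀ c ∈ D, ∀ᵐ ξ ∂P, 0 ≤ ∑ i, c i * (f i ξ - w i ξ) + (u c ξ - u 0 ξ) := by
    intro c hc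
    have hpiece : ∀ n, ∀ᵐ ξ ∂P, ξ ∈ R n →
        0 ≤ ∑ i, c i * (f i ξ - w i ξ) + (u c ξ - u 0 ξ) := by
      intro n
      rw [← ae_restrict_iff' (hRm n)]
      refine ae_nonneg_of_forall_setIntegral_nonneg (hki c hc).integrableOn fun S hS _ => ?_
      rw [Measure.restrict_restrict hS]
      have hSn := hS.inter (hRm n)
      have hnn := (hN c hc).nonneg _ hSn
      have hγeq : ∀ i, γ i (S ∩ R n) = ∫ ξ in S ∩ R n, (f i ξ - w i ξ) ∂P := fun i => by
        rw [integral_sub (hfi i).integrableOn (hwi i).integrableOn,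
          ← hloc i n _ Set.inter_subset_right hSn]
        ring
      simp only [hγeq] at hnn
      rw [integral_add (integrable_finsetSum _ fun i _ =>
          ((hfw i).const_mul (c i)).integrableOn) (h.integrable_sub hc).integrableOn,
        integral_finsetSum _ fun i _ => ((hfw i).const_mul (c i)).integrableOn]
      simpa only [integral_const_mul] using hnn
    filter_upwards [ae_all_iff.2 hpiece, hcover] with ξ h1 ⟨n, hn⟩
    exact h1 n hn
  -- Along the tails `Z n` the integrals vanish, so nonnegativity of the charge passes to the
  -- escaped mass alone.
  have hsing : ∀ c ∈ D, 0 ≤ ∑ i, c i * m i := by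
    intro c hc
    have h1 : Tendsto (fun n => ∑ i, c i * (γ i (Z n) + ∫ ξ in Z n, w i ξ ∂P)
        + (∫ ξ in Z n, (u c ξ - u 0 ξ) ∂P - ∑ i, c i * ∫ ξ in Z n, w i ξ ∂P)) atTop
        (𝓝 (∑ i, c i * m i + (0 - ∑ i, c i * 0))) :=
      (tendsto_finsetSum _ fun i _ => (hlim' i).const_mul (c i)).add
        ((hvanish _ (h.integrable_sub hc)).sub
          (tendsto_finsetSum _ fun i _ => (hvanish _ (hwi i)).const_mul (c i)))
    simp only [mul_zero, Finset.sum_const_zero, sub_zero, add_zero] at h1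
    refine ge_of_tendsto' h1 fun n => ?_
    have hnn := (hN c hc).nonneg _ (hZm n)
    simp only [mul_add, Finset.sum_add_distrib]
    linarith
  -- `f i - w i` is the density of `γ i`; the constant `m i` compensates its mean.
  refine ⟨fun i ξ => f i ξ - w i ξ + m i, fun i =>
    (hfw i).add (integrable_const _), fun i => ?_, ?_⟩
  · change ∫ ξ, (f i ξ - w i ξ + m i) ∂P = 0
    rw [integral_add (hfw i) (integrable_const _), integral_sub (hfi i) (hwi i)]
    simp [hm]
  have hrat : ∀ᵐ ξ ∂P, ∀ q : ι → ℚ, (u 0 ξ : EReal) ≤ ψ (fun i => q i) ξ +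
      ((∑ i, (q i : ℝ) * (f i ξ - w i ξ + m i) : ℝ) : EReal) := by
    refine ae_all_iff.2 fun q => ?_
    by_cases hq : (fun i => (q i : ℝ)) ∈ D
    · filter_upwards [hdens _ hq, h.ae_eq _ hq] with ξ h1 h2
      rw [h2, ← EReal.coe_add, EReal.coe_le_coe_iff]
      have := hsing _ hq
      simp only [mul_add, Finset.sum_add_distrib]
      linarith
    · refine ae_of_all _ fun ξ => ?_
      rw [not_not.1 fun hne => hq (h.mem_of_ne_top _ ξ hne), EReal.top_add_coe]
      exact le_top
  have hall : ∀ᵐ ξ ∂P, ∀ i, ψ (Pi.single i 1) ξ = u (Pi.single i 1) ξ :=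
    ae_all_iff.2 fun i => h.ae_eq _ (h.single_mem i)
  filter_upwards [hrat, h.ae_eq 0 h.zero_mem, hall] with ξ h1 h2 h3 c
  refine h.le_add_of_forall_rat (M := |u 0 ξ| + ∑ i, |u (Pi.single i 1) ξ|) ?_ (fun i => ?_) h1 c
  · rw [h2, EReal.coe_le_coe_iff]
    linarith [le_abs_self (u 0 ξ),
      Finset.sum_nonneg fun i (_ : i ∈ Finset.univ) => abs_nonneg (u (Pi.single i 1) ξ)]
  · rw [h3 i, EReal.coe_le_coe_iff]
    have := Finset.single_le_sum (f := fun i => |u (Pi.single i 1) ξ|)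
      (fun j _ => abs_nonneg _) (Finset.mem_univ i)
    linarith [le_abs_self (u (Pi.single i 1) ξ), abs_nonneg (u 0 ξ)]

end IsMinimalIntegrand

/-! ### Extended expectations -/

section ExtExpectation

variable {Ξ : Type*} [MeasurableSpace Ξ] {P : Measure Ξ} {X Y : Ξ → EReal}

theorem EReal.coe_ennreal_eq_coe_toReal {a : ENNReal} (h : a ≠ ⊤) : (a : EReal) = (a.toReal : ℝ) := by
  lift a to NNReal using h
  rfl

theorem extExpectation_congr_ae (h : X =ᵐ[P] Y) : extExpectation P X = extExpectation P Y := by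
  have h1 : ∫⁻ ξ, (X ξ).toENNReal ∂P = ∫⁻ ξ, (Y ξ).toENNReal ∂P :=
    lintegral_congr_ae (h.mono fun ξ hξ => by simp only [hξ])
  have h2 : ∫⁻ ξ, (-X ξ).toENNReal ∂P = ∫⁻ ξ, (-Y ξ).toENNReal ∂P :=
    lintegral_congr_ae (h.mono fun ξ hξ => by simp only [hξ])
  rw [extExpectation, extExpectation, h1, h2]

theorem extExpectation_mono_ae (h : X ≤ᵐ[P] Y) : extExpectation P X ≤ extExpectation P Y := by
  have h1 : ∫⁻ ξ, (X ξ).toENNReal ∂P ≤ ∫⁻ ξ, (Y ξ).toENNReal ∂P :=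
    lintegral_mono_ae (h.mono fun ξ hξ => EReal.toENNReal_le_toENNReal hξ)
  have h2 : ∫⁻ ξ, (-Y ξ).toENNReal ∂P ≤ ∫⁻ ξ, (-X ξ).toENNReal ∂P :=
    lintegral_mono_ae (h.mono fun ξ hξ => EReal.toENNReal_le_toENNReal (EReal.neg_le_neg_iff.2 hξ))
  unfold extExpectation
  by_cases hY : ∫⁻ ξ, (Y ξ).toENNReal ∂P = ⊤
  · rw [if_pos hY]; exact le_top
  · rw [if_neg hY, if_neg (ne_top_of_le_ne_top hY h1)]
    exact EReal.sub_le_sub (by exact_mod_cast h1) (by exact_mod_cast h2)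

theorem extExpectation_coe {Z : Ξ → ℝ} (hZ : Integrable Z P) :
    extExpectation P (fun ξ => (Z ξ : EReal)) = ((∫ ξ, Z ξ ∂P : ℝ) : EReal) := by
  have h1 : ∫⁻ ξ, ENNReal.ofReal (Z ξ) ∂P ≠ ⊤ := hZ.lintegral_lt_top.ne
  have h2 : ∫⁻ ξ, ENNReal.ofReal (-Z ξ) ∂P ≠ ⊤ := hZ.neg.lintegral_lt_top.ne
  change (if ∫⁻ ξ, ENNReal.ofReal (Z ξ) ∂P = ⊤ then ⊤ else
    ((∫⁻ ξ, ENNReal.ofReal (Z ξ) ∂P : ENNReal) : EReal) -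
      ((∫⁻ ξ, ENNReal.ofReal (-Z ξ) ∂P : ENNReal) : EReal)) = _
  rw [if_neg h1, integral_eq_lintegral_pos_part_sub_lintegral_neg_part hZ,
    EReal.coe_ennreal_eq_coe_toReal h1, EReal.coe_ennreal_eq_coe_toReal h2, EReal.coe_sub]

theorem extExpectation_top [IsProbabilityMeasure P] :
    extExpectation P (fun _ => ⊤) = ⊤ := by
  simp [extExpectation]

theorem ae_eq_toReal_of_extExpectation (hX : Measurable X) (htop : extExpectation P X ≠ ⊤)
    (hbot : extExpectation P X ≠ ⊥) :
    (∀ᵐ ξ ∂P, X ξ = (X ξ).toReal) ∧ Integrable (fun ξ => (X ξ).toReal) P := by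
  have h1 : ∫⁻ ξ, (X ξ).toENNReal ∂P ≠ ⊤ := fun h => htop (if_pos h)
  have h2 : ∫⁻ ξ, (-X ξ).toENNReal ∂P ≠ ⊤ := fun h => hbot (by
    rw [extExpectation, if_neg h1, h, EReal.coe_ennreal_top, EReal.sub_top])
  have hm1 : Measurable fun ξ => (X ξ).toENNReal := hX.ereal_toENNReal
  have hm2 : Measurable fun ξ => (-X ξ).toENNReal := hX.neg.ereal_toENNReal
  have hae : ∀ᵐ ξ ∂P, X ξ = (X ξ).toReal := by
    filter_upwards [ae_lt_top hm1 h1, ae_lt_top hm2 h2] with ξ k1 k2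
    refine (EReal.coe_toReal ?_ ?_).symm
    · intro h; simp [h] at k1
    · intro h; simp [h] at k2
  refine ⟨hae, hX.ereal_toReal.aestronglyMeasurable, ?_⟩
  have hle : ∫⁻ ξ, ‖(X ξ).toReal‖ₑ ∂P ≤
      ∫⁻ ξ, ((X ξ).toENNReal + (-X ξ).toENNReal) ∂P := by
    refine lintegral_mono_ae (hae.mono fun ξ hξ => ?_)
    generalize (X ξ).toReal = x at hξ
    rw [hξ, ← EReal.coe_neg, EReal.real_coe_toENNReal, EReal.real_coe_toENNReal,
      Real.enorm_eq_ofReal_abs]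
    rcases le_total 0 x with hx | hx
    · rw [abs_of_nonneg hx]; exact le_self_add
    · rw [abs_of_nonpos hx]; exact le_add_self
  rw [lintegral_add_left hm1] at hle
  exact hle.trans_lt (ENNReal.add_lt_top.2 ⟨h1.lt_top, h2.lt_top⟩)

end ExtExpectation

/-! ### Coordinates and multipliers for the two-stage program -/

/-- A multiplier on the coordinates of a linearly independent family is represented by a vector. -/
theorem LinearIndependent.exists_inner_eq_sum {E ι : Type*} [NormedAddCommGroup E]
    [InnerProductSpace ℝ E] [FiniteDimensional ℝ E] [Fintype ι] {v : ι → E}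
    (hv : LinearIndependent ℝ v) :
    ∃ w : ι → E, ∀ c s : ι → ℝ, inner ℝ (∑ i, c i • v i) (∑ i, s i • w i) = ∑ i, c i * s i := by
  classical
  obtain ⟨r, hr⟩ := LinearMap.exists_leftInverse_of_injective (Fintype.linearCombination ℝ v)
    (LinearMap.ker_eq_bot.2 hv.fintypeLinearCombination_injective)
  refine ⟨fun j => (InnerProductSpace.toDual ℝ E).symm
    (LinearMap.toContinuousLinearMap ((LinearMap.proj j : (ι → ℝ) →ₗ[ℝ] ℝ) ∘ₗ r)), fun c s => ?_⟩
  rw [inner_sum]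
  refine Finset.sum_congr rfl fun j _ => ?_
  rw [inner_smul_right, real_inner_comm, InnerProductSpace.toDual_symm_apply]
  have : r (∑ i, c i • v i) = c := by
    have := LinearMap.congr_fun hr c
    simpa [Fintype.linearCombination_apply] using this
  change s j * r (∑ i, c i • v i) j = c j * s j
  rw [this, mul_comm]

namespace TwoStageProgram

variable {n₁ n₂ m₁ m₂ : ℕ} {Ξ : Type*} {S : TwoStageProgram n₁ n₂ m₁ m₂ Ξ}

theorem phi_of_notMem {y : Vec n₁} (hy : y ∉ S.feasible₁) (ξ : Ξ) : S.phi y ξ = ⊤ := by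
  simp [phi, hy]

variable [MeasurableSpace Ξ] {P : Measure Ξ} [IsProbabilityMeasure P]

/-- At a minimizer of the expected cost, the scenario costs have subgradients with mean zero. -/
theorem exists_nonanticipativity_multiplier (hS : S.IsConvex) (hfin : S.FiniteExpectedCost P)
    {χ : Vec n₁} (hχ : χ ∈ S.feasible₁) (hbot : extExpectation P (S.phi χ) ≠ ⊥)
    (hmin : ∀ y ∈ S.feasible₁, extExpectation P (S.phi χ) ≤ extExpectation P (S.phi y)) :
    ∃ σ : Ξ → Vec n₁, Integrable σ P ∧ ∫ ξ, σ ξ ∂P = 0 ∧ ∀ᵐ ξ ∂P, ∀ y,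
      ((S.phi χ ξ).toReal : EReal) ≤ S.phi y ξ + ((inner ℝ (y - χ) (σ ξ) : ℝ) : EReal) := by
  classical
  -- The basis is drawn from the feasible directions themselves, so the standard basis vectors are
  -- feasible coordinates.
  obtain ⟨b, hbs, hbspan, hbli⟩ := exists_linearIndependent ℝ ((fun y => y - χ) '' S.feasible₁)
  have : Fintype b := hbli.setFinite.fintype
  obtain ⟨w, hw⟩ := hbli.exists_inner_eq_sum
  set L : (b → ℝ) → Vec n₁ := fun c => χ + ∑ i, c i • (i : Vec n₁) with hL
  have hL0 : L 0 = χ := by simp [hL]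
  have hLs : ∀ i : b, L (Pi.single i 1) = χ + i := fun i => by
    simp [hL, Pi.single_apply, ite_smul]
  have hreal : ∀ y ∈ S.feasible₁, (∀ᵐ ξ ∂P, S.phi y ξ = (S.phi y ξ).toReal) ∧
      Integrable (fun ξ => (S.phi y ξ).toReal) P := fun y hy =>
    ae_eq_toReal_of_extExpectation (hS.measurable_phi y) (hfin y hy).ne
      fun h => hbot (le_bot_iff.1 (h ▸ hmin y hy))
  have hval : ∀ y ∈ S.feasible₁,
      extExpectation P (S.phi y) = ((∫ ξ, (S.phi y ξ).toReal ∂P : ℝ) : EReal) := fun y hy => by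
    rw [← extExpectation_coe (hreal y hy).2]
    exact extExpectation_congr_ae (hreal y hy).1
  have hI : IsMinimalIntegrand P (L ⁻¹' S.feasible₁) (fun c => S.phi (L c))
      (fun c ξ => (S.phi (L c) ξ).toReal) :=
    { zero_mem := by rwa [Set.mem_preimage, hL0]
      single_mem := fun i => by
        obtain ⟨y, hy, hyi⟩ := hbs i.2
        rw [Set.mem_preimage, hLs, ← hyi, add_sub_cancel]
        exact hy
      mem_of_ne_top := fun c ξ h => mem_feasible₁_of_phi_ne_top h
      convex_epigraph := fun ξ p hp q hq a b ha hb hab => by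
        have hlin : L (a • p.1 + b • q.1) = a • L p.1 + b • L q.1 := by
          simp only [hL, Pi.add_apply, Pi.smul_apply, smul_eq_mul, add_smul, mul_smul,
            Finset.sum_add_distrib, ← Finset.smul_sum, smul_add]
          rw [add_add_add_comm, ← add_smul, hab, one_smul]
        change S.phi (L (a • p.1 + b • q.1)) ξ ≤ ((a * p.2 + b * q.2 : ℝ) : EReal)
        rw [hlin]
        exact hS.phi_combo_le hp hq ha hb hab
      integrable := fun c hc => (hreal _ hc).2
      ae_eq := fun c hc => (hreal _ hc).1
      integral_le := fun c hc => by
        have := hmin _ hc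
        rwa [hval _ hχ, hval _ hc, EReal.coe_le_coe_iff, ← hL0] at this }
  obtain ⟨s, hsi, hs0, hs⟩ := hI.exists_multiplier
  refine ⟨fun ξ => ∑ i, s i ξ • w i, integrable_finsetSum _ fun i _ => (hsi i).smul_const _, ?_, ?_⟩
  · rw [integral_finsetSum _ fun i _ => (hsi i).smul_const _]
    simp [integral_smul_const, hs0]
  filter_upwards [hs] with ξ hξ y
  by_cases hy : y ∈ S.feasible₁
  · have hmem : y - χ ∈ Submodule.span ℝ (Set.range ((↑) : b → Vec n₁)) := by
      rw [Subtype.range_coe, hbspan]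
      exact Submodule.subset_span ⟨y, hy, rfl⟩
    obtain ⟨c, hc⟩ := (Submodule.mem_span_range_iff_exists_fun ℝ).1 hmem
    have hyL : L c = y := by simp only [hL, hc, add_sub_cancel]
    have := hξ c
    rw [hL0, hyL] at this
    rwa [← hc, hw c fun i => s i ξ]
  · rw [phi_of_notMem hy, EReal.top_add_coe]
    exact le_top

omit [IsProbabilityMeasure P] in
theorem objective_eq {y : Lp (Vec n₁) ⊤ P} {χ : Vec n₁} (h : (y, χ) ∈ stateVectorFeasible n₁ P) :
    S.objective P y = extExpectation P (S.phi χ) :=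
  extExpectation_congr_ae (by
    change ∀ᵐ ξ ∂P, y ξ - χ = 0 at h
    filter_upwards [h] with ξ hξ
    rw [sub_eq_zero.1 hξ])

omit [IsProbabilityMeasure P] in
theorem lagrangian_eq {y : Lp (Vec n₁) ⊤ P} {χ : Vec n₁} (h : (y, χ) ∈ stateVectorFeasible n₁ P)
    (σ : Lp (Vec n₁) 1 P) : S.lagrangian P y χ σ = extExpectation P (S.phi χ) :=
  extExpectation_congr_ae (by
    change ∀ᵐ ξ ∂P, y ξ - χ = 0 at h
    filter_upwards [h] with ξ hξ
    rw [hξ, inner_zero_left, sub_eq_zero.1 hξ, EReal.coe_zero, add_zero])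

theorem const_mem_stateVectorFeasible (χ : Vec n₁) :
    (Lp.const ⊤ P χ, χ) ∈ stateVectorFeasible n₁ P := by
  change ∀ᵐ ξ ∂P, Lp.const ⊤ P χ ξ - χ = 0
  filter_upwards [Lp.coeFn_const (p := ⊤) (μ := P) (c := χ)] with ξ hξ
  rw [hξ, Function.const_apply, sub_self]

theorem IsOptimal.exists_multiplier (hS : S.IsConvex) (hfin : S.FiniteExpectedCost P)
    {y : Lp (Vec n₁) ⊤ P} {χ : Vec n₁} (hopt : S.IsOptimal P y χ) :
    ∃ σ ∈ multipliers n₁ P, S.MinimizesLagrangian P y χ σ := by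
  obtain ⟨hfeas, hle⟩ := hopt
  have hmin : ∀ z, extExpectation P (S.phi χ) ≤ extExpectation P (S.phi z) := fun z => by
    have hz := const_mem_stateVectorFeasible (P := P) z
    rw [← objective_eq hfeas, ← objective_eq hz]
    exact hle _ hz
  have hzero : (0 : Lp (Vec n₁) 1 P) ∈ multipliers n₁ P := by
    change ∫ ξ, (0 : Lp (Vec n₁) 1 P) ξ ∂P = 0
    rw [integral_congr_ae (Lp.coeFn_zero _ _ _)]
    simp
  -- At value `-∞` the zero multiplier works trivially.
  by_cases hbot : extExpectation P (S.phi χ) = ⊥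
  · refine ⟨0, hzero, fun z ζ => ?_⟩
    rw [lagrangian_eq hfeas, hbot]
    exact bot_le
  by_cases hχ : χ ∈ S.feasible₁
  · obtain ⟨σ, hσ, hσ0, hsub⟩ :=
      exists_nonanticipativity_multiplier hS hfin hχ hbot fun z _ => hmin z
    obtain ⟨hae, hint⟩ := ae_eq_toReal_of_extExpectation (hS.measurable_phi χ) (hfin χ hχ).ne hbot
    refine ⟨hσ.toL1 σ, ?_, fun z ζ => ?_⟩
    · change ∫ ξ, hσ.toL1 σ ξ ∂P = 0
      rw [integral_congr_ae hσ.coeFn_toL1, hσ0]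
    have hinner : Integrable (fun ξ => inner ℝ (χ - ζ) (σ ξ)) P := hσ.const_inner _
    -- Since `σ` has mean zero, adding `⟨χ - ζ, σ⟩` leaves the expectation unchanged. This absorbs
    -- the arbitrary `ζ` and reduces the claim to the pointwise subgradient inequality.
    have heq : extExpectation P (S.phi χ) =
        extExpectation P fun ξ => (((S.phi χ ξ).toReal + inner ℝ (χ - ζ) (σ ξ) : ℝ) : EReal) := by
      rw [extExpectation_coe (Z := fun ξ => (S.phi χ ξ).toReal + inner ℝ (χ - ζ) (σ ξ))
        (hint.add hinner), integral_add hint hinner, integral_inner hσ, hσ0,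
        inner_zero_right, add_zero, ← extExpectation_coe hint]
      exact extExpectation_congr_ae hae
    rw [lagrangian_eq hfeas, heq]
    refine extExpectation_mono_ae ?_
    filter_upwards [hsub, hσ.coeFn_toL1] with ξ h1 h2
    have hsplit : inner ℝ (z ξ - ζ) (σ ξ) = inner ℝ (z ξ - χ) (σ ξ) + inner ℝ (χ - ζ) (σ ξ) := by
      rw [← inner_add_left, sub_add_sub_cancel]
    rw [h2, hsplit, EReal.coe_add, EReal.coe_add, ← add_assoc]
    exact add_le_add (h1 (z ξ)) le_rfl
  -- If the optimal `χ` is infeasible its cost is `+∞`, so by `hfin` no feasible point exists and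
  -- the Lagrangian is identically `+∞`.
  · have hempty : ∀ z ∉ S.feasible₁, extExpectation P (S.phi z) = ⊤ := fun z hz => by
      rw [← extExpectation_top (P := P)]
      exact congrArg _ (funext (phi_of_notMem hz))
    have hnone : ∀ z, z ∉ S.feasible₁ := fun z hz =>
      absurd (hmin z) (not_le.2 (by rw [hempty χ hχ]; exact hfin z hz))
    refine ⟨0, hzero, fun z ζ => ?_⟩
    have htop : S.lagrangian P z ζ 0 = ⊤ := by
      rw [lagrangian, ← extExpectation_top (P := P)]
      exact congrArg _ (funext fun ξ => by rw [phi_of_notMem (hnone _), EReal.top_add_coe])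
    rw [htop]
    exact le_top

end TwoStageProgram

theorem proposition4 {n₁ n₂ m₁ m₂ : ℕ} {Ξ : Type*} [MeasurableSpace Ξ]
    (P : MeasureTheory.Measure Ξ) [MeasureTheory.IsProbabilityMeasure P]
    (S : TwoStageProgram n₁ n₂ m₁ m₂ Ξ) (hS : S.IsConvex) (hfin : S.FiniteExpectedCost P)
    (ybar : MeasureTheory.Lp (Vec n₁) ⊤ P) (χbar : Vec n₁)
    (hfeas : (ybar, χbar) ∈ TwoStageProgram.stateVectorFeasible n₁ P) :
    (S.IsOptimal P ybar χbar ↔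
      ∃ σbar ∈ TwoStageProgram.multipliers n₁ P, S.MinimizesLagrangian P ybar χbar σbar) ∧
    ∀ σbar ∈ TwoStageProgram.multipliers n₁ P,
      S.MinimizesLagrangian P ybar χbar σbar → S.IsLagrangianSaddlePoint P ybar χbar σbar := by
  refine ⟨⟨fun h => h.exists_multiplier hS hfin, ?_⟩, fun σ _ hσ => ⟨fun τ => ?_, hσ⟩⟩
  · rintro ⟨σ, -, hσ⟩
    refine ⟨hfeas, fun q hq => ?_⟩
    have := hσ q.1 q.2
    rwa [TwoStageProgram.lagrangian_eq hfeas, TwoStageProgram.lagrangian_eq hq,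
      ← TwoStageProgram.objective_eq hfeas, ← TwoStageProgram.objective_eq hq] at this
  · rw [TwoStageProgram.lagrangian_eq hfeas, TwoStageProgram.lagrangian_eq hfeas]
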